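/- For $x\in\mathbb C$ let $(x)_n=x(x+1)\cdots(x+n-1)$ for integers $n\ge 0$ (with $(x)_0=1$), and $(x)_k=\Gamma(x+k)/\Gamma(x)$ for complex $k$. For $n\ge0$ and $k\in\mathbb C\setminus\{-1,-2,-3,\dots\}$ put $$T(n,k)=\left(\frac{-1}{48}\right)^n\frac{\left(\frac12-k\right)_n\left(\frac12+3k\right)_n\left(\frac14\right)_n\left(\frac34\right)_n}{\left(\frac12\right)_n(1)_n(1+k)_n^2}\cdot\frac{(28n+3)(2n+1)+k(40n+18)}{2n+1}.$$ (a) For every $k\in\mathbb C\setminus\{-1,-2,-3,\dots\}$ the series $\sum_{n\ge0}T(n,k)$ converges (absolutely), and $$\sum_{n=0}^{\infty}T(n,k)=\frac{16}{\sqrt3\,\pi}\cdot\frac{(1)_k^2}{\left(\frac16\right)_k\left(\frac56\right)_k},$$ where the right-hand side is read as $0$ if $\frac16+k$ or $\frac56+k$ is a nonpositive integer (a pole of the denominator). (b) The identity is WZ-demonstrable: put $G(n,k)=T(n,k)\,\frac{(1/6)_k(5/6)_k}{(1)_k^2}$. There is a function $F(n,k)$ such that $(F,G)$ is a Wilf–Zeilberger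 pair on the set of all integers $n\ge0$ and all $k\in\mathbb C$ with $6k\notin\mathbb Z$, and on this set $F(0,k)=0$ and $\lim_{n\to\infty}F(n,k)=0$. Here $(F,G)$ is called a Wilf–Zeilberger pair if both are hypergeometric in the two variables (for each $A\in\{F,G\}$ there are nonzero polynomials $P,Q,\tilde P,\tilde Q\in\mathbb C[n,k]$ with $Q(n,k)A(n+1,k)=P(n,k)A(n,k)$ and $\tilde Q(n,k)A(n,k+1)=\tilde P(n,k)A(n,k)$) and $F(n+1,k)-F(n,k)=G(n,k+1)-G(n,k)$. -/

import Mathlib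

/-- The rising factorial `(x)_n = x (x + 1) ⋯ (x + n - 1)` for a natural number `n`. -/
noncomputable def poch (x : ℂ) (n : ℕ) : ℂ :=
  (ascPochhammer ℂ n).eval x

/-- The rising factorial `(x)_k = Γ(x + k) / Γ(x)` for a complex number `k`. -/
noncomputable def cpoch (x k : ℂ) : ℂ :=
  Complex.Gamma (x + k) / Complex.Gamma x

/-- The `n`-th summand of the series, as a function of the parameter `k`. -/
noncomputable def summand (n : ℕ) (k : ℂ) : ℂ :=
  (-1 / 48 : ℂ) ^ n *
    ((poch (1 / 2 - k) n * poch (1 / 2 + 3 * k) n * poch (1 / 4) n * poch (3 / 4) n) /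
      (poch (1 / 2) n * poch 1 n * poch (1 + k) n ^ 2)) *
    (((28 * (n : ℂ) + 3) * (2 * (n : ℂ) + 1) + k * (40 * (n : ℂ) + 18)) / (2 * (n : ℂ) + 1))

/-- `A(n, k)` is hypergeometric in its two variables, for `k` in the domain `D`: the quotients
`A(n+1, k) / A(n, k)` and `A(n, k+1) / A(n, k)` are nonzero rational functions of `n` and `k`
(written with the denominators cleared, as `A` may vanish somewhere). -/
def IsHypergeometric (D : Set ℂ) (A : ℕ → ℂ → ℂ) : Prop :=
  (∃ P Q : MvPolynomial (Fin 2) ℂ, P ≠ 0 ∧ Q ≠ 0 ∧ ∀ n : ℕ, ∀ k ∈ D,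
    MvPolynomial.eval ![(n : ℂ), k] Q * A (n + 1) k =
      MvPolynomial.eval ![(n : ℂ), k] P * A n k) ∧
  (∃ P Q : MvPolynomial (Fin 2) ℂ, P ≠ 0 ∧ Q ≠ 0 ∧ ∀ n : ℕ, ∀ k ∈ D,
    MvPolynomial.eval ![(n : ℂ), k] Q * A n (k + 1) =
      MvPolynomial.eval ![(n : ℂ), k] P * A n k)

/-- A Wilf–Zeilberger pair, for `k` in the domain `D` (which is to be stable under `k ↦ k + 1`). -/
def IsWZPair (D : Set ℂ) (F G : ℕ → ℂ → ℂ) : Prop :=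
  IsHypergeometric D F ∧ IsHypergeometric D G ∧
    ∀ n : ℕ, ∀ k ∈ D, F (n + 1) k - F n k = G n (k + 1) - G n k

/-- The WZ method applies to `∑ n, G(n, k)`: `G` has a WZ mate `F` with `F(0, k) = 0` and
`F(n, k) → 0` as `n → ∞`. -/
def WZDemonstrable (D : Set ℂ) (G : ℕ → ℂ → ℂ) : Prop :=
  ∃ F : ℕ → ℂ → ℂ, IsWZPair D F G ∧ (∀ k ∈ D, F 0 k = 0) ∧
    ∀ k ∈ D, Filter.Tendsto (fun n : ℕ => F n k) Filter.atTop (nhds 0)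

/-- The generic parameters: `6 k` is not an integer. They avoid all poles and all zeros of the
Pochhammer symbols involved. -/
def genericParameters : Set ℂ :=
  {k | ∀ m : ℤ, 6 * k ≠ (m : ℂ)}

open Filter Topology

/-! ### Rising factorials -/

/-! Write S(k) for the sum of the series and c(k) for `normFactor k`. Since c(k+1) = `normRatio k` ·
c(k), the WZ equation reduces to the rational identity `mate_succ_sub`. Summed over n it telescopes:
`mate` vanishes at n = 0 and tends to 0, so S(k) = `normRatio k` · S(k+1) (`tsum_summand_eq`), and
c(k)S(k) has period 1 where the recurrence of c is available.

For Re k ≥ 0 its value is found by letting the parameter go to infinity along k + M + 1. There c · M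
tends to 1/(2π) (`tendsto_normFactor`, by Euler's limit and the reflection formula), while S/M tends
to 32/√3: dominated convergence reduces S/M to `hasSum_limit_series`, the even part of a binomial
series. The product is 16/(√3 π).

The remaining k are reached by stepping left with the same recurrence, written for 1/c so that the
poles of Γ do no harm (`tsum_summand`). -/

theorem poch_zero (x : ℂ) : poch x 0 = 1 := by simp [poch]

theorem poch_succ (x : ℂ) (n : ℕ) : poch x (n + 1) = poch x n * (x + n) :=
  ascPochhammer_succ_eval n x

theorem mul_poch_add_one (x : ℂ) (n : ℕ) : x * poch (x + 1) n = poch x n * (x + n) := by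
  induction n with
  | zero => simp [poch_zero]
  | succ n ih =>
    rw [poch_succ, poch_succ, ← mul_assoc, ih]
    push_cast
    ring

theorem poch_succ_left (x : ℂ) (n : ℕ) : poch x (n + 1) = x * poch (x + 1) n := by
  rw [mul_poch_add_one, poch_succ]

theorem poch_ne_zero {x : ℂ} (hx : ∀ m : ℕ, x ≠ -(m : ℂ)) (n : ℕ) : poch x n ≠ 0 := by
  induction n with
  | zero => simp [poch_zero]
  | succ n ih =>
    rw [poch_succ]
    refine mul_ne_zero ih fun h => hx n ?_
    linear_combination h

theorem ne_neg_natCast_of_re_pos {x : ℂ} (hx : 0 < x.re) (m : ℕ) : x ≠ -(m : ℂ) := by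
  rintro rfl
  have : (0 : ℝ) ≤ m := m.cast_nonneg
  simp at hx
  linarith

theorem poch_ne_zero_of_re_pos {x : ℂ} (hx : 0 < x.re) (n : ℕ) : poch x n ≠ 0 :=
  poch_ne_zero (ne_neg_natCast_of_re_pos hx) n

theorem poch_half_ne_zero (n : ℕ) : poch (1 / 2) n ≠ 0 :=
  poch_ne_zero_of_re_pos (by norm_num) n

theorem poch_one_ne_zero (n : ℕ) : poch 1 n ≠ 0 :=
  poch_ne_zero_of_re_pos (by norm_num) n

theorem one_add_ne_neg_natCast {k : ℂ} (hk : ∀ m : ℕ, k ≠ -((m : ℂ) + 1)) (m : ℕ) :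
    1 + k ≠ -(m : ℂ) := fun h => hk m (by linear_combination h)

theorem add_one_ne_neg {k : ℂ} (hk : ∀ m : ℕ, k ≠ -((m : ℂ) + 1)) (m : ℕ) :
    k + 1 ≠ -((m : ℂ) + 1) := fun h => hk (m + 1) (by push_cast; linear_combination h)

theorem two_mul_add_ne_zero (n : ℕ) : 2 * (n : ℂ) + 1 ≠ 0 := by
  exact_mod_cast (by omega : 2 * n + 1 ≠ 0)

/-! ### The Wilf–Zeilberger mate -/

/-- The hypergeometric part of `summand`. -/
noncomputable def hyperTerm (n : ℕ) (k : ℂ) : ℂ :=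
  (-1 / 48 : ℂ) ^ n *
    ((poch (1 / 2 - k) n * poch (1 / 2 + 3 * k) n * poch (1 / 4) n * poch (3 / 4) n) /
      (poch (1 / 2) n * poch 1 n * poch (1 + k) n ^ 2))

/-- The numerator of the rational factor of `summand`. -/
noncomputable def linFactor (n k : ℂ) : ℂ :=
  (28 * n + 3) * (2 * n + 1) + k * (40 * n + 18)

theorem summand_eq (n : ℕ) (k : ℂ) :
    summand n k = hyperTerm n k * (linFactor n k / (2 * n + 1)) := rfl

/-- The quotient of the normalizing factors of the series at `k + 1` and at `k`. -/
noncomputable def normRatio (k : ℂ) : ℂ :=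
  (k + 1 / 6) * (k + 5 / 6) / (k + 1) ^ 2

/-- The Wilf–Zeilberger mate of `summand`, without the normalizing factor. -/
noncomputable def mate : ℕ → ℂ → ℂ
  | 0, _ => 0
  -- This is `hyperTerm` times the certificate (64/9)(4n - 1)n / (n - 1/2 - k), taken at n + 1. The
  -- denominator is cancelled against the last factor of (1/2 - k)_{n+1}, hence the index n there,
  -- so half-integer k need no exception.
  | n + 1, k => 64 / 9 * (4 * n + 3) * ((-1 / 48 : ℂ) ^ (n + 1) *
      ((poch (1 / 2 - k) n * poch (1 / 2 + 3 * k) (n + 1) * poch (1 / 4) (n + 1) *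
        poch (3 / 4) (n + 1)) / (poch (1 / 2) (n + 1) * poch 1 n * poch (1 + k) (n + 1) ^ 2)))

/-- With x = 1/2 + 3k, three unit shifts take x to x + 3, and x(x + 1)(x + 2) is the cubic
prefactor. This is where 1/6 and 5/6 in the normalizing factor come from. -/
theorem poch_triple_shift (k : ℂ) (n : ℕ) :
    27 * ((k + 1 / 6) * (k + 1 / 2) * (k + 5 / 6)) * poch (1 / 2 + 3 * (k + 1)) n =
      poch (1 / 2 + 3 * k) n *
        ((1 / 2 + 3 * k + n) * (3 / 2 + 3 * k + n) * (5 / 2 + 3 * k + n)) := by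
  have h0 := mul_poch_add_one (1 / 2 + 3 * k) n
  have h1 := mul_poch_add_one (3 / 2 + 3 * k) n
  have h2 := mul_poch_add_one (5 / 2 + 3 * k) n
  rw [show 1 / 2 + 3 * k + 1 = 3 / 2 + 3 * k by ring] at h0
  rw [show 3 / 2 + 3 * k + 1 = 5 / 2 + 3 * k by ring] at h1
  rw [show 5 / 2 + 3 * k + 1 = 1 / 2 + 3 * (k + 1) by ring] at h2
  linear_combination (1 / 2 + 3 * k) * (3 / 2 + 3 * k) * h2 +
    (1 / 2 + 3 * k) * (5 / 2 + 3 * k + n) * h1 +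
    (5 / 2 + 3 * k + n) * (3 / 2 + 3 * k + n) * h0

/-- The factor k + 1/2 split off from (-1/2 - k)_{n+1} completes the numerator of `normRatio` to the
cubic of `poch_triple_shift`, so nothing is divided by k + 1/2. -/
theorem normRatio_mul_hyperTerm_succ {k : ℂ} (hk : ∀ m : ℕ, k ≠ -((m : ℂ) + 1)) (n : ℕ) :
    normRatio k * hyperTerm (n + 1) (k + 1) = -((-1 / 48 : ℂ) ^ (n + 1) *
      ((poch (1 / 2 - k) n * poch (1 / 2 + 3 * k) (n + 1) * poch (1 / 4) (n + 1) *
        poch (3 / 4) (n + 1)) / (poch (1 / 2) (n + 1) * poch 1 (n + 1) *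
          poch (1 + k) (n + 1) ^ 2))) *
      ((3 / 2 + 3 * k + n) * (5 / 2 + 3 * k + n) * (7 / 2 + 3 * k + n) /
        (27 * (k + n + 2) ^ 2)) := by
  have hK := poch_ne_zero (one_add_ne_neg_natCast hk) (n + 1)
  have hK' := mul_poch_add_one (1 + k) (n + 1)
  have hB := poch_triple_shift k (n + 1)
  have hE := poch_half_ne_zero (n + 1)
  have hF := poch_one_ne_zero (n + 1)
  have h1 : k + 1 ≠ 0 := fun h => hk 0 (by push_cast; linear_combination h)
  have h2 : k + n + 2 ≠ 0 := fun h => hk (n + 1) (by push_cast; linear_combination h)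
  have hA : poch (1 / 2 - (k + 1)) (n + 1) = -(k + 1 / 2) * poch (1 / 2 - k) n := by
    rw [poch_succ_left, show 1 / 2 - (k + 1) + 1 = 1 / 2 - k by ring]
    ring
  have hK'' : poch (1 + (k + 1)) (n + 1) = poch (1 + k) (n + 1) * (k + n + 2) / (k + 1) := by
    rw [eq_div_iff h1, ← add_assoc]
    push_cast at hK'
    linear_combination hK'
  rw [hyperTerm, normRatio, hA, hK'']
  generalize poch (1 / 2 + 3 * (k + 1)) (n + 1) = B' at *
  generalize poch (1 / 2 + 3 * k) (n + 1) = B at *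
  generalize poch (1 + k) (n + 1) = K at *
  push_cast at hB
  have hB' : (k + 1 / 6) * (k + 1 / 2) * (k + 5 / 6) * B' = B *
      ((3 / 2 + 3 * k + n) * (5 / 2 + 3 * k + n) * (7 / 2 + 3 * k + n)) / 27 := by
    linear_combination hB / 27
  calc _ = -((-1 / 48 : ℂ) ^ (n + 1) * (poch (1 / 2 - k) n * poch (1 / 4) (n + 1) *
        poch (3 / 4) (n + 1))) / (poch (1 / 2) (n + 1) * poch 1 (n + 1) * K ^ 2 *
          (k + n + 2) ^ 2) * ((k + 1 / 6) * (k + 1 / 2) * (k + 5 / 6) * B') := by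
        field_simp
    _ = _ := by
        rw [hB']
        field_simp

theorem mate_succ_sub {k : ℂ} (hk : ∀ m : ℕ, k ≠ -((m : ℂ) + 1)) (n : ℕ) :
    mate (n + 1) k - mate n k = normRatio k * summand n (k + 1) - summand n k := by
  have h1 : k + 1 ≠ 0 := fun h => hk 0 (by push_cast; linear_combination h)
  cases n with
  | zero =>
    have h1' : 1 + k ≠ 0 := by rwa [add_comm]
    simp only [mate, summand, normRatio, poch_succ, poch_zero, add_comm (1 : ℂ) k]
    push_cast
    simp only [add_zero]
    field_simp
    ring
  | succ n =>
    have hK := poch_ne_zero (one_add_ne_neg_natCast hk) (n + 1)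
    have hE := poch_half_ne_zero (n + 1)
    have hF := poch_one_ne_zero n
    have h2 : k + n + 2 ≠ 0 := fun h => hk (n + 1) (by push_cast; linear_combination h)
    have h3 : (n : ℂ) + 1 ≠ 0 := by exact_mod_cast n.succ_ne_zero
    have h4 : (n : ℂ) * 2 + 3 ≠ 0 := by exact_mod_cast (by omega : n * 2 + 3 ≠ 0)
    rw [summand_eq, ← mul_assoc, normRatio_mul_hyperTerm_succ hk, summand_eq, hyperTerm, mate, mate,
      poch_succ (1 / 2 - k) n, poch_succ (1 / 2 + 3 * k) (n + 1), poch_succ (1 / 4) (n + 1),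
      poch_succ (3 / 4) (n + 1), poch_succ (1 / 2) (n + 1), poch_succ 1 n,
      poch_succ (1 + k) (n + 1), linFactor, linFactor, pow_succ _ (n + 1)]
    push_cast
    rw [show 1 + k + ((n : ℂ) + 1) = k + n + 2 by ring, add_comm (1 : ℂ) (n : ℂ),
      show 2 * ((n : ℂ) + 1) + 1 = n * 2 + 3 by ring,
      show (1 : ℂ) / 2 + (n + 1) = (n * 2 + 3) / 2 by ring]
    field_simp
    ring

/-! ### Hypergeometric recurrences -/

theorem hyperTerm_succ_left {k : ℂ} (hk : ∀ m : ℕ, k ≠ -((m : ℂ) + 1)) (n : ℕ) :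
    48 * (1 / 2 + n) * (1 + n) * (1 + k + n) ^ 2 * hyperTerm (n + 1) k =
      -((1 / 2 - k + n) * (1 / 2 + 3 * k + n) * (1 / 4 + n) * (3 / 4 + n)) * hyperTerm n k := by
  have hK := poch_ne_zero (one_add_ne_neg_natCast hk) (n + 1)
  have hE := poch_half_ne_zero (n + 1)
  have hF := poch_one_ne_zero (n + 1)
  simp only [hyperTerm, pow_succ _ n]
  rw [poch_succ] at hK hE hF
  simp only [poch_succ]
  obtain ⟨hK1, hK2⟩ := mul_ne_zero_iff.1 hK
  obtain ⟨hE1, hE2⟩ := mul_ne_zero_iff.1 hE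
  obtain ⟨hF1, hF2⟩ := mul_ne_zero_iff.1 hF
  generalize (1 / 2 + (n : ℂ)) = e at *
  generalize (1 + (n : ℂ)) = f at *
  generalize (1 + k + (n : ℂ)) = h at *
  field_simp

/-- The factor n on the left is needed: at n = 0 the right side vanishes with `mate 0 k`, whereas
`mate 1 k` need not. -/
theorem mate_succ_left {k : ℂ} (hk : ∀ m : ℕ, k ≠ -((m : ℂ) + 1)) (n : ℕ) :
    48 * (4 * n - 1) * (1 / 2 + n) * n * (1 + k + n) ^ 2 * mate (n + 1) k =
      -((4 * n + 3) * (n - 1 / 2 - k) * (1 / 2 + 3 * k + n) * (1 / 4 + n) * (3 / 4 + n)) *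
        mate n k := by
  cases n with
  | zero => simp [mate]
  | succ n =>
    have hK := poch_ne_zero (one_add_ne_neg_natCast hk) (n + 2)
    have hE := poch_half_ne_zero (n + 2)
    have hF := poch_one_ne_zero (n + 1)
    rw [mate, mate, pow_succ _ (n + 1)]
    rw [poch_succ] at hK hE hF
    rw [poch_succ (1 / 2 - k) n, poch_succ (1 / 2 + 3 * k) (n + 1), poch_succ (1 / 4) (n + 1),
      poch_succ (3 / 4) (n + 1), poch_succ (1 / 2) (n + 1), poch_succ 1 n,
      poch_succ (1 + k) (n + 1)]
    obtain ⟨hK1, hK2⟩ := mul_ne_zero_iff.1 hK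
    obtain ⟨hE1, hE2⟩ := mul_ne_zero_iff.1 hE
    obtain ⟨hF1, hF2⟩ := mul_ne_zero_iff.1 hF
    rw [show ((n + 1 : ℕ) : ℂ) - 1 / 2 - k = 1 / 2 - k + n by push_cast; ring,
      show 4 * ((n + 1 : ℕ) : ℂ) - 1 = 4 * n + 3 by push_cast; ring]
    generalize (1 / 2 + ((n + 1 : ℕ) : ℂ)) = e at *
    generalize (1 + k + ((n + 1 : ℕ) : ℂ)) = h at *
    rw [show ((n + 1 : ℕ) : ℂ) = 1 + n by push_cast; ring]
    generalize (1 + (n : ℂ)) = f at *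
    generalize (1 / 2 - k + (n : ℂ)) = a
    clear hK hE hF
    generalize poch (1 / 2) (n + 1) = E at *
    generalize poch 1 n = F at *
    generalize poch (1 + k) (n + 1) = K at *
    generalize poch (1 / 2 - k) n = A at *
    generalize poch (1 / 2 + 3 * k) (n + 1) = B at *
    generalize poch (1 / 4) (n + 1) = C at *
    generalize poch (3 / 4) (n + 1) = D at *
    generalize 1 / 2 + 3 * k + f = b
    generalize 1 / 4 + f = c
    generalize 3 / 4 + f = d
    generalize 4 * (n : ℂ) + 3 = x
    generalize (-1 / 48 : ℂ) ^ (n + 1) = y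
    generalize 4 * f + 3 = z
    have hq : e * f * h ^ 2 ≠ 0 := mul_ne_zero (mul_ne_zero hE2 hF2) (pow_ne_zero 2 hK2)
    have key : A * a * (B * b) * (C * c) * (D * d) / (E * e * (F * f) * (K * h) ^ 2) *
        (e * f * h ^ 2) = A * B * C * D / (E * F * K ^ 2) * (a * b * c * d) := by
      rw [show E * e * (F * f) * (K * h) ^ 2 = E * F * K ^ 2 * (e * f * h ^ 2) by ring,
        ← div_div, div_mul_cancel₀ _ hq]
      ring
    linear_combination (-64 / 9) * x * z * y * key

/-- Two independent indices let one identity serve both `hyperTerm` (equal indices) and `mate`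
(where the first index lags by one). -/
theorem poch_shift_quotient {k : ℂ} (hk : ∀ m : ℕ, k ≠ -((m : ℂ) + 1)) (m n : ℕ) :
    27 * (m - 1 / 2 - k) * (1 + k + n) ^ 2 * (normRatio k *
      (poch (1 / 2 - (k + 1)) m * poch (1 / 2 + 3 * (k + 1)) n / poch (1 + (k + 1)) n ^ 2)) =
      -((1 / 2 + 3 * k + n) * (3 / 2 + 3 * k + n) * (5 / 2 + 3 * k + n)) *
        (poch (1 / 2 - k) m * poch (1 / 2 + 3 * k) n / poch (1 + k) n ^ 2) := by
  have hK := poch_ne_zero (one_add_ne_neg_natCast hk) n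
  have hK' := mul_poch_add_one (1 + k) n
  have hB := poch_triple_shift k n
  have hA := mul_poch_add_one (-1 / 2 - k) m
  have h1 : k + 1 ≠ 0 := fun h => hk 0 (by push_cast; linear_combination h)
  have h2 : 1 + k + n ≠ 0 := fun h => hk n (by linear_combination h)
  rw [show -1 / 2 - k + 1 = 1 / 2 - k by ring] at hA
  rw [show 1 / 2 - (k + 1) = -1 / 2 - k by ring, normRatio]
  have hK'' : poch (1 + (k + 1)) n = poch (1 + k) n * (1 + k + n) / (k + 1) := by
    rw [eq_div_iff h1, ← add_assoc]
    linear_combination hK'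
  rw [hK'']
  generalize poch (1 / 2 + 3 * (k + 1)) n = B' at *
  generalize poch (1 / 2 + 3 * k) n = B at *
  generalize poch (1 + k) n = K at *
  generalize poch (-1 / 2 - k) m = A' at *
  generalize poch (1 / 2 - k) m = A at *
  generalize 1 + k + (n : ℂ) = h at *
  generalize k + 1 = l at *
  have key : 27 * ((k + 1 / 6) * (k + 5 / 6)) * (A' * (-1 / 2 - k + m)) * B' =
      -(A * (B * ((1 / 2 + 3 * k + n) * (3 / 2 + 3 * k + n) * (5 / 2 + 3 * k + n)))) := by
    rw [← hA, ← hB]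
    ring
  calc _ = 27 * ((k + 1 / 6) * (k + 5 / 6)) * (A' * (-1 / 2 - k + m)) * B' / K ^ 2 := by
        field_simp
        ring
    _ = _ := by
        rw [key]
        ring

theorem normRatio_mul_hyperTerm {k : ℂ} (hk : ∀ m : ℕ, k ≠ -((m : ℂ) + 1)) (n : ℕ) :
    27 * (n - 1 / 2 - k) * (1 + k + n) ^ 2 * (normRatio k * hyperTerm n (k + 1)) =
      -((1 / 2 + 3 * k + n) * (3 / 2 + 3 * k + n) * (5 / 2 + 3 * k + n)) * hyperTerm n k := by
  have h := poch_shift_quotient hk n n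
  rw [hyperTerm, hyperTerm]
  linear_combination (-1 / 48 : ℂ) ^ n * poch (1 / 4) n * poch (3 / 4) n /
    (poch (1 / 2) n * poch 1 n) * h

theorem normRatio_mul_mate {k : ℂ} (hk : ∀ m : ℕ, k ≠ -((m : ℂ) + 1)) (n : ℕ) :
    27 * (n - 3 / 2 - k) * (1 + k + n) ^ 2 * (normRatio k * mate n (k + 1)) =
      -((1 / 2 + 3 * k + n) * (3 / 2 + 3 * k + n) * (5 / 2 + 3 * k + n)) * mate n k := by
  cases n with
  | zero => simp [mate]
  | succ n =>
    have h := poch_shift_quotient hk n (n + 1)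
    rw [mate, mate, show ((n + 1 : ℕ) : ℂ) - 3 / 2 - k = n - 1 / 2 - k by push_cast; ring]
    linear_combination 64 / 9 * (4 * n + 3) * (-1 / 48 : ℂ) ^ (n + 1) * poch (1 / 4) (n + 1) *
      poch (3 / 4) (n + 1) / (poch (1 / 2) (n + 1) * poch 1 n) * h

/-! ### The normalizing factor -/

/-- The normalizing factor of the series. -/
noncomputable def normFactor (k : ℂ) : ℂ :=
  cpoch (1 / 6) k * cpoch (5 / 6) k / cpoch 1 k ^ 2

theorem cpoch_add_one {x k : ℂ} (h : x + k ≠ 0) : cpoch x (k + 1) = (x + k) * cpoch x k := by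
  rw [cpoch, ← add_assoc, Complex.Gamma_add_one _ h, cpoch, mul_div_assoc]

theorem normFactor_add_one {k : ℂ} (h1 : k + 1 / 6 ≠ 0) (h5 : k + 5 / 6 ≠ 0) (h6 : k + 1 ≠ 0) :
    normFactor (k + 1) = normRatio k * normFactor k := by
  rw [add_comm] at h1 h5 h6
  rw [normFactor, cpoch_add_one h1, cpoch_add_one h5, cpoch_add_one h6, normFactor, normRatio,
    add_comm k 1, add_comm k (1 / 6), add_comm k (5 / 6)]
  generalize 1 + k = l
  ring

theorem genericParameters.ne_neg {k : ℂ} (hk : k ∈ genericParameters) (m : ℕ) :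
    k ≠ -((m : ℂ) + 1) := by
  intro h
  refine hk (-(6 * (m + 1))) ?_
  rw [h]
  push_cast
  ring

theorem genericParameters.normFactor_add_one {k : ℂ} (hk : k ∈ genericParameters) :
    normFactor (k + 1) = normRatio k * normFactor k := by
  refine _root_.normFactor_add_one (fun h => hk (-1) ?_) (fun h => hk (-5) ?_)
    (fun h => hk (-6) ?_) <;> push_cast <;> linear_combination 6 * h

/-! ### The Wilf–Zeilberger pair -/

theorem MvPolynomial.ne_zero_of_eval_ne_zero {σ R : Type*} [CommSemiring R] {f : σ → R}
    {P : MvPolynomial σ R} (h : MvPolynomial.eval f P ≠ 0) : P ≠ 0 := by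
  rintro rfl
  simp at h

open MvPolynomial in
theorem isHypergeometric_mate :
    IsHypergeometric genericParameters fun n k => mate n k * normFactor k := by
  refine ⟨⟨-((4 * X 0 + 3) * (X 0 - C (1 / 2) - X 1) * (C (1 / 2) + 3 * X 1 + X 0) *
      (C (1 / 4) + X 0) * (C (3 / 4) + X 0)),
      48 * (4 * X 0 - 1) * (C (1 / 2) + X 0) * X 0 * (1 + X 1 + X 0) ^ 2,
      ne_zero_of_eval_ne_zero (f := ![0, 0]) (by norm_num),
      -- The factor `X 0` vanishes at the origin, so another test point is taken.
      ne_zero_of_eval_ne_zero (f := ![1, 0]) (by norm_num), fun n k hk => ?_⟩,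
    ⟨-((C (1 / 2) + 3 * X 1 + X 0) * (C (3 / 2) + 3 * X 1 + X 0) * (C (5 / 2) + 3 * X 1 + X 0)),
      27 * (X 0 - C (3 / 2) - X 1) * (1 + X 1 + X 0) ^ 2,
      ne_zero_of_eval_ne_zero (f := ![0, 0]) (by norm_num),
      ne_zero_of_eval_ne_zero (f := ![0, 0]) (by norm_num), fun n k hk => ?_⟩⟩
  · have h := mate_succ_left (genericParameters.ne_neg hk) n
    simp
    linear_combination normFactor k * h
  · have h := normRatio_mul_mate (genericParameters.ne_neg hk) n
    simp only [genericParameters.normFactor_add_one hk]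
    simp
    linear_combination normFactor k * h

open MvPolynomial in
theorem isHypergeometric_summand :
    IsHypergeometric genericParameters fun n k => summand n k * normFactor k := by
  refine ⟨⟨-((C (1 / 2) - X 1 + X 0) * (C (1 / 2) + 3 * X 1 + X 0) *
      (C (1 / 4) + X 0) * (C (3 / 4) + X 0)) *
      ((28 * (X 0 + 1) + 3) * (2 * (X 0 + 1) + 1) + X 1 * (40 * (X 0 + 1) + 18)) * (2 * X 0 + 1),
      48 * (C (1 / 2) + X 0) * (1 + X 0) * (1 + X 1 + X 0) ^ 2 *
      ((28 * X 0 + 3) * (2 * X 0 + 1) + X 1 * (40 * X 0 + 18)) * (2 * (X 0 + 1) + 1),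
      ne_zero_of_eval_ne_zero (f := ![0, 0]) (by norm_num),
      ne_zero_of_eval_ne_zero (f := ![0, 0]) (by norm_num), fun n k hk => ?_⟩,
    ⟨-((C (1 / 2) + 3 * X 1 + X 0) * (C (3 / 2) + 3 * X 1 + X 0) * (C (5 / 2) + 3 * X 1 + X 0)) *
      ((28 * X 0 + 3) * (2 * X 0 + 1) + (X 1 + 1) * (40 * X 0 + 18)),
      27 * (X 0 - C (1 / 2) - X 1) * (1 + X 1 + X 0) ^ 2 *
      ((28 * X 0 + 3) * (2 * X 0 + 1) + X 1 * (40 * X 0 + 18)),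
      ne_zero_of_eval_ne_zero (f := ![0, 0]) (by norm_num),
      ne_zero_of_eval_ne_zero (f := ![0, 0]) (by norm_num), fun n k hk => ?_⟩⟩
  · have h := hyperTerm_succ_left (genericParameters.ne_neg hk) n
    have h1 := two_mul_add_ne_zero n
    have h3 := two_mul_add_ne_zero (n + 1)
    push_cast at h3
    simp [summand_eq, linFactor]
    have e1 := div_mul_cancel₀ ((28 * (n : ℂ) + 3) * (2 * n + 1) + k * (40 * n + 18)) h1
    have e3 := div_mul_cancel₀
      ((28 * ((n : ℂ) + 1) + 3) * (2 * (n + 1) + 1) + k * (40 * (n + 1) + 18)) h3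
    generalize ((28 * (n : ℂ) + 3) * (2 * n + 1) + k * (40 * n + 18)) / (2 * n + 1) = u at *
    generalize ((28 * ((n : ℂ) + 1) + 3) * (2 * (n + 1) + 1) + k * (40 * (n + 1) + 18)) /
      (2 * (n + 1) + 1) = v at *
    rw [← e1, ← e3]
    linear_combination normFactor k * u * v * (2 * n + 1) * (2 * (n + 1) + 1) * h
  · have h := normRatio_mul_hyperTerm (genericParameters.ne_neg hk) n
    simp only [genericParameters.normFactor_add_one hk]
    simp [summand_eq, linFactor]
    linear_combination normFactor k *
      ((28 * (n : ℂ) + 3) * (2 * n + 1) + (k + 1) * (40 * n + 18)) *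
      ((28 * (n : ℂ) + 3) * (2 * n + 1) + k * (40 * n + 18)) / (2 * n + 1) * h

theorem isWZPair_mate_summand : IsWZPair genericParameters
    (fun n k => mate n k * normFactor k) (fun n k => summand n k * normFactor k) := by
  refine ⟨isHypergeometric_mate, isHypergeometric_summand, fun n k hk => ?_⟩
  have h := mate_succ_sub (genericParameters.ne_neg hk) n
  simp only [genericParameters.normFactor_add_one hk]
  linear_combination normFactor k * h

/-! ### The sum of the limiting series -/

theorem hasSum_poch_binomial (a : ℂ) {x : ℂ} (hx : ‖x‖ < 1) :
    HasSum (fun n : ℕ => poch a n / poch 1 n * x ^ n) (1 / (1 - x) ^ a) := by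
  have h := (Complex.one_div_one_sub_cpow_hasFPowerSeriesOnBall_zero a).hasSum (y := x)
    (by simpa [enorm_eq_nnnorm, ← NNReal.coe_lt_one] using hx)
  rw [zero_add] at h
  convert! h using 2 with n
  have h1 := Ring.factorial_nsmul_multichoose_eq_ascPochhammer a n
  rw [Polynomial.ascPochhammer_smeval_eq_eval, nsmul_eq_mul] at h1
  rw [FormalMultilinearSeries.ofScalars_apply_eq, smul_eq_mul, ← Ring.multichoose_eq, poch, poch,
    ← h1, ascPochhammer_eval_one, mul_div_cancel_left₀ _ (by exact_mod_cast n.factorial_ne_zero)]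

/-- The even-indexed part of a power series. -/
theorem HasSum.even_part {c : ℕ → ℂ} {x a b : ℂ} (ha : HasSum (fun n => c n * x ^ n) a)
    (hb : HasSum (fun n => c n * (-x) ^ n) b) :
    HasSum (fun n => c (2 * n) * (x ^ 2) ^ n) ((a + b) / 2) := by
  have h := (ha.add hb).div_const 2
  rw [← Function.Injective.hasSum_iff (g := fun n : ℕ => 2 * n)
    (fun m n h => by simpa using h)] at h
  · convert! h using 2 with n
    simp only [Function.comp]
    rw [Even.neg_pow (even_two_mul n), ← pow_mul]
    ring
  · intro n hn
    have hn' : Odd n := by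
      rw [← Nat.not_even_iff_odd]
      rintro ⟨m, rfl⟩
      exact hn ⟨m, by ring⟩
    rw [hn'.neg_pow]
    ring

/-- Duplication (x)_{2n} = 4^n (x/2)_n ((x+1)/2)_n at x = 1/2 and x = 1. It identifies the limiting
coefficients with even-indexed binomial ones. -/
theorem poch_half_two_mul (n : ℕ) :
    poch (1 / 2) (2 * n) / poch 1 (2 * n) =
      poch (1 / 4) n * poch (3 / 4) n / (poch (1 / 2) n * poch 1 n) := by
  induction n with
  | zero => simp [poch_zero]
  | succ n ih =>
    have hE := poch_half_ne_zero n
    have hF := poch_one_ne_zero n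
    have hG := poch_one_ne_zero (2 * n)
    have h1 := two_mul_add_ne_zero n
    have h2 : (n : ℂ) + 1 ≠ 0 := by exact_mod_cast n.succ_ne_zero
    rw [show 2 * (n + 1) = 2 * n + 1 + 1 by ring, poch_succ (1 / 2) (2 * n + 1),
      poch_succ (1 / 2) (2 * n), poch_succ 1 (2 * n + 1), poch_succ 1 (2 * n), poch_succ (1 / 4),
      poch_succ (3 / 4), poch_succ (1 / 2) n, poch_succ 1 n]
    push_cast
    calc _ = poch (1 / 2) (2 * n) / poch 1 (2 * n) *
          ((1 / 2 + 2 * n) * (1 / 2 + (2 * n + 1)) / ((1 + 2 * n) * (1 + (2 * n + 1)))) := by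
          rw [← mul_div_mul_comm]
          ring
      _ = poch (1 / 4) n * poch (3 / 4) n / (poch (1 / 2) n * poch 1 n) *
          ((1 / 4 + n) * (3 / 4 + n) / ((1 / 2 + n) * (1 + n))) := by
          rw [ih]
          congr 1
          rw [show (1 : ℂ) + 2 * n = 2 * n + 1 by ring,
            show (1 : ℂ) + (2 * n + 1) = 2 * (n + 1) by ring,
            show (1 : ℂ) / 2 + n = (2 * n + 1) / 2 by ring, add_comm (1 : ℂ) n]
          field_simp
          ring
      _ = _ := by
          rw [← mul_div_mul_comm]
          ring

/-- The power series of `20 (1 - x)^(-1/2) - 4 (1 - √(1 - x)) / x`. -/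
theorem hasSum_weighted_binomial {x s : ℂ} (hx : ‖x‖ < 1) (hx0 : x ≠ 0)
    (hs : (1 - x) ^ (1 / 2 : ℂ) = s) :
    HasSum (fun n : ℕ => poch (1 / 2) n / poch 1 n * (20 - 2 / (n + 1)) * x ^ n)
      (20 / s - 4 * (1 - s) / x) := by
  have h := hasSum_poch_binomial (1 / 2) hx
  -- The series of √(1 - x), stripped of its constant term, supplies the weight 1/(n + 1), because
  -- (-1/2)_{n+1} = -(1/2)(1/2)_n.
  have h' := hasSum_poch_binomial (-1 / 2) hx
  rw [hs] at h
  rw [show (-1 / 2 : ℂ) = -(1 / 2) by ring, Complex.cpow_neg, hs, one_div s⁻¹, inv_inv,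
    show (-(1 / 2) : ℂ) = -1 / 2 by ring, ← hasSum_nat_add_iff' 1] at h'
  convert! (h.mul_left 20).add (h'.mul_left (4 / x)) using 1
  · ext n
    have h1 := poch_one_ne_zero n
    have h2 : (n : ℂ) + 1 ≠ 0 := by exact_mod_cast n.succ_ne_zero
    rw [poch_succ_left (-1 / 2), poch_succ 1 n, pow_succ,
      show (-1 / 2 + 1 : ℂ) = 1 / 2 by ring, add_comm (1 : ℂ)]
    field_simp
    ring
  · simp [poch_zero]
    field_simp
    ring

theorem sqrt_cpow (y : ℝ) (hy : 0 ≤ y) : ((y / 4 : ℝ) : ℂ) ^ (1 / 2 : ℂ) = ((√y / 2 : ℝ) : ℂ) := by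
  rw [show (1 / 2 : ℂ) = ((1 / 2 : ℝ) : ℂ) by norm_num, ← Complex.ofReal_cpow (by positivity),
    ← Real.sqrt_eq_rpow, Real.sqrt_div hy, show (4 : ℝ) = 2 ^ 2 by norm_num,
    Real.sqrt_sq (by norm_num)]

/-- At index 2n the weight 20 - 2/(n + 1) becomes (40n + 18)/(2n + 1). The values at x = 1/4 and x =
-1/4 are 64/√3 - 16 and 16, the √5 terms cancelling, and their mean is 32/√3. -/
theorem hasSum_limit_series :
    HasSum (fun n : ℕ => (1 / 16 : ℂ) ^ n *
      (poch (1 / 4) n * poch (3 / 4) n / (poch (1 / 2) n * poch 1 n)) *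
      ((40 * n + 18) / (2 * n + 1))) (32 / (√3 : ℝ)) := by
  have h1 := hasSum_weighted_binomial (x := 1 / 4) (s := ((√3 / 2 : ℝ) : ℂ)) (by norm_num)
    (by norm_num) (by rw [← sqrt_cpow 3 (by norm_num)]; norm_num)
  have h2 := hasSum_weighted_binomial (x := -(1 / 4)) (s := ((√5 / 2 : ℝ) : ℂ)) (by norm_num)
    (by norm_num) (by rw [← sqrt_cpow 5 (by norm_num)]; norm_num)
  convert! h1.even_part h2 using 1
  · ext n
    have := two_mul_add_ne_zero n
    rw [poch_half_two_mul, show (1 / 4 : ℂ) ^ 2 = 1 / 16 by norm_num, mul_comm, ← mul_assoc,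
      mul_comm]
    rw [mul_comm _ ((1 / 16 : ℂ) ^ n), mul_assoc]
    congr 1
    rw [mul_comm]
    congr 1
    push_cast
    rw [sub_div' this]
    ring
  · have e3 : ((√3 : ℝ) : ℂ) ^ 2 = 3 := by
      rw [← Complex.ofReal_pow, Real.sq_sqrt (by norm_num)]; norm_num
    have e5 : ((√5 : ℝ) : ℂ) ^ 2 = 5 := by
      rw [← Complex.ofReal_pow, Real.sq_sqrt (by norm_num)]; norm_num
    have n3 : ((√3 : ℝ) : ℂ) ≠ 0 := fun h => by simp [h] at e3
    have n5 : ((√5 : ℝ) : ℂ) ≠ 0 := fun h => by simp [h] at e5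
    push_cast
    generalize ((√3 : ℝ) : ℂ) = u at *
    generalize ((√5 : ℝ) : ℂ) = v at *
    field_simp
    linear_combination (-16 * v) * e3 + 16 * u * e5

/-! ### Convergence -/

theorem summable_of_ratio_tendsto {f ρ : ℕ → ℂ} {l : ℂ} (hl : ‖l‖ < 1)
    (h : ∀ n, f (n + 1) = ρ n * f n) (hρ : Tendsto ρ atTop (𝓝 l)) : Summable f := by
  obtain ⟨r, hr, hr1⟩ := exists_between hl
  refine summable_of_ratio_norm_eventually_le hr1 ?_
  filter_upwards [hρ.norm.eventually_le_const hr] with n hn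
  rw [h, norm_mul]
  gcongr

theorem tendsto_add_div_add (a b : ℂ) :
    Tendsto (fun n : ℕ => (a + n) / (b + n)) atTop (𝓝 1) := by
  simpa using tendsto_add_mul_div_add_mul_atTop_nhds a b 1 (one_ne_zero (α := ℂ))

/-- The weight n + 1 absorbs the linear growth of both the rational factor of `summand` and the
certificate of `mate`. -/
theorem summable_mul_hyperTerm {k : ℂ} (hk : ∀ m : ℕ, k ≠ -((m : ℂ) + 1)) :
    Summable fun n : ℕ => ((n : ℂ) + 1) * hyperTerm n k := by
  refine summable_of_ratio_tendsto (l := -1 / 48) (ρ := fun n : ℕ => -1 / 48 *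
    ((1 / 2 - k + n) / (1 / 2 + n)) * ((1 / 2 + 3 * k + n) / (1 + n)) *
    ((1 / 4 + n) / (1 + k + n)) * ((3 / 4 + n) / (1 + k + n)) * ((2 + n) / (1 + n)))
    (by norm_num) (fun n => ?_) ?_
  · have h := hyperTerm_succ_left hk n
    have h1 : (1 : ℂ) + n ≠ 0 := by rw [add_comm]; exact_mod_cast n.succ_ne_zero
    have h2 : (1 : ℂ) / 2 + n ≠ 0 := fun h => two_mul_add_ne_zero n (by linear_combination 2 * h)
    have h3 : 1 + k + n ≠ 0 := fun h => hk n (by linear_combination h)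
    push_cast
    have h4 : 48 * (1 / 2 + n) * (1 + n) * (1 + k + n) ^ 2 ≠ 0 := by
      simp only [ne_eq, mul_eq_zero, not_or, pow_eq_zero_iff two_ne_zero]
      exact ⟨⟨⟨by norm_num, h2⟩, h1⟩, h3⟩
    have h5 := eq_div_of_mul_eq h4 ((mul_comm _ _).trans h)
    rw [h5]
    generalize (1 : ℂ) / 2 + n = e at *
    generalize 1 + k + (n : ℂ) = d at *
    generalize hx : (1 : ℂ) + n = x at *
    rw [show (n : ℂ) + 1 + 1 = 2 + n by ring, show (n : ℂ) + 1 = x by rw [← hx]; ring]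
    field_simp
  · simpa using (((((tendsto_add_div_add _ _).const_mul (-1 / 48 : ℂ)).mul
      (tendsto_add_div_add _ _)).mul (tendsto_add_div_add _ _)).mul
      (tendsto_add_div_add _ _)).mul (tendsto_add_div_add 2 1)

theorem norm_linFactor_div_le (n : ℕ) (k : ℂ) :
    ‖linFactor n k / (2 * n + 1)‖ ≤ (28 + 20 * ‖k‖) * (n + 1) := by
  have h := two_mul_add_ne_zero n
  have e : linFactor n k / (2 * n + 1) = (28 * n + 3 : ℕ) +
      k * ((40 * n + 18 : ℕ) / (2 * n + 1 : ℕ)) := by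
    rw [linFactor]
    push_cast
    rw [add_div, mul_div_cancel_right₀ _ h, mul_div_assoc]
  rw [e]
  refine (norm_add_le _ _).trans ?_
  rw [norm_mul, norm_div, Complex.norm_natCast, Complex.norm_natCast, Complex.norm_natCast]
  have h1 : ((40 * n + 18 : ℕ) : ℝ) / (2 * n + 1 : ℕ) ≤ 20 := by
    rw [div_le_iff₀ (by positivity)]
    push_cast
    linarith
  have h2 := mul_le_mul_of_nonneg_left h1 (norm_nonneg k)
  have h3 : 0 ≤ ‖k‖ * n := by positivity
  push_cast at *
  nlinarith

theorem summable_summand {k : ℂ} (hk : ∀ m : ℕ, k ≠ -((m : ℂ) + 1)) :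
    Summable fun n => summand n k := by
  refine .of_norm_bounded ((summable_mul_hyperTerm hk).norm.mul_left (28 + 20 * ‖k‖)) fun n => ?_
  have h := norm_linFactor_div_le n k
  have h1 : ‖(n : ℂ) + 1‖ = n + 1 := by exact_mod_cast Complex.norm_natCast (n + 1)
  rw [summand_eq, norm_mul, norm_mul, h1]
  nlinarith [mul_le_mul_of_nonneg_left h (norm_nonneg (hyperTerm n k))]

theorem mate_mul_eq (n : ℕ) (k : ℂ) :
    mate n k * (n - 1 / 2 - k) = 64 / 9 * (4 * n - 1) * n * hyperTerm n k := by
  cases n with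
  | zero => simp [mate]
  | succ n =>
    have h2 : (n : ℂ) + 1 ≠ 0 := by exact_mod_cast n.succ_ne_zero
    rw [mate, hyperTerm, poch_succ (1 / 2 - k), poch_succ 1 n, add_comm (1 : ℂ)]
    push_cast
    rw [← mul_div_mul_right (poch (1 / 2 - k) n * _ * _ * _) _ h2]
    ring

theorem tendsto_mate {k : ℂ} (hk : ∀ m : ℕ, k ≠ -((m : ℂ) + 1)) :
    Tendsto (fun n => mate n k) atTop (𝓝 0) := by
  have h1 := (summable_mul_hyperTerm hk).tendsto_atTop_zero
  have h2 := tendsto_add_mul_div_add_mul_atTop_nhds (-1 : ℂ) (-1 / 2 - k) 4 one_ne_zero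
  have h3 := tendsto_add_div_add 0 1
  have h := ((h1.mul h2).mul h3).const_mul (64 / 9)
  simp only [zero_mul, mul_zero] at h
  refine h.congr' ?_
  -- The certificate has a pole at n = k + 1/2, which large n avoid.
  have hne : ∀ᶠ n : ℕ in atTop, (n : ℂ) - 1 / 2 - k ≠ 0 := by
    obtain ⟨N, hN⟩ := exists_nat_gt ‖1 / 2 + k‖
    filter_upwards [eventually_ge_atTop N] with n hn h0
    have : (n : ℂ) = 1 / 2 + k := by linear_combination h0
    have h4 := congrArg norm this
    rw [Complex.norm_natCast] at h4
    have : (N : ℝ) ≤ n := by exact_mod_cast hn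
    linarith
  filter_upwards [hne] with n hn
  have h5 : (n : ℂ) + 1 ≠ 0 := by exact_mod_cast n.succ_ne_zero
  rw [eq_div_of_mul_eq hn (mate_mul_eq n k), show -1 / 2 - k + 1 * (n : ℂ) = n - 1 / 2 - k by ring,
    add_comm (1 : ℂ) n]
  field_simp
  ring

theorem tsum_summand_eq {k : ℂ} (hk : ∀ m : ℕ, k ≠ -((m : ℂ) + 1)) :
    ∑' n, summand n k = normRatio k * ∑' n, summand n (k + 1) := by
  have h1 := (summable_summand (add_one_ne_neg hk)).hasSum.mul_left (normRatio k)
  have h := (h1.sub (summable_summand hk).hasSum).tendsto_sum_nat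
  simp only [← mate_succ_sub hk, Finset.sum_range_sub (fun n => mate n k)] at h
  have h0 := (tendsto_mate hk).sub_const (mate 0 k)
  have := tendsto_nhds_unique h h0
  simp only [mate, sub_zero] at this
  linear_combination -this

/-! ### Asymptotics of the normalizing factor -/

theorem poch_eq_prod (x : ℂ) (n : ℕ) : poch x n = ∏ j ∈ Finset.range n, (x + j) := by
  induction n with
  | zero => simp [poch_zero]
  | succ n ih => rw [poch_succ, ih, Finset.prod_range_succ]

/-- Euler's limit for Γ(s): its denominator s(s + 1)⋯(s + M) has M + 1 factors and equals Γ(s + M +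
1)/Γ(s). Hence the shift by M + 1 in the later limits. -/
theorem tendsto_Gamma_add_div {s : ℂ} (hs : 0 < s.re) :
    Tendsto (fun M : ℕ => Complex.Gamma (s + (M + 1 : ℕ)) /
      (M ^ s * M.factorial)) atTop (𝓝 1) := by
  have h0 := Complex.Gamma_ne_zero_of_re_pos hs
  have h := (tendsto_const_nhds (x := Complex.Gamma s)).div (Complex.GammaSeq_tendsto_Gamma s) h0
  rw [div_self h0] at h
  refine h.congr fun M => ?_
  have h1 := Complex.Gamma_add_nat_div_Gamma_eq (n := M + 1) s (ne_neg_natCast_of_re_pos hs)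
  rw [div_eq_iff h0] at h1
  rw [h1, ← poch, poch_eq_prod, Pi.div_apply, Complex.GammaSeq]
  simp only [div_eq_mul_inv, mul_inv, inv_inv]
  ring

theorem Gamma_sixth_mul :
    Complex.Gamma (1 / 6) * Complex.Gamma (5 / 6) = 2 * Real.pi := by
  have h := Complex.Gamma_mul_Gamma_one_sub (1 / 6)
  rw [show (1 - 1 / 6 : ℂ) = 5 / 6 by norm_num] at h
  rw [h, show (Real.pi : ℂ) * (1 / 6) = ((Real.pi / 6 : ℝ) : ℂ) by push_cast; ring,
    ← Complex.ofReal_sin, Real.sin_pi_div_six]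
  push_cast
  ring

theorem tendsto_normFactor {k : ℂ} (hk : 0 ≤ k.re) :
    Tendsto (fun M : ℕ => normFactor (k + (M + 1 : ℕ)) * M) atTop (𝓝 (1 / (2 * Real.pi))) := by
  have h1 : Tendsto _ _ _ := tendsto_Gamma_add_div (s := 1 / 6 + k) (by simp; linarith)
  have h5 : Tendsto _ _ _ := tendsto_Gamma_add_div (s := 5 / 6 + k) (by simp; linarith)
  have h6 : Tendsto _ _ _ := tendsto_Gamma_add_div (s := 1 + k) (by simp; linarith)
  have h := ((h1.mul h5).div (h6.pow 2) (by norm_num)).const_mul (1 / (2 * Real.pi : ℂ))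
  simp only [one_pow, mul_one, div_one] at h
  refine h.congr' ?_
  filter_upwards [eventually_ne_atTop 0] with M hM
  have hM' : (M : ℂ) ≠ 0 := by exact_mod_cast hM
  have hf : (M.factorial : ℂ) ≠ 0 := by exact_mod_cast M.factorial_ne_zero
  -- The exponents leave one spare power: 2(1 + k) = (1/6 + k) + (5/6 + k) + 1. Thus the normalizing
  -- factor decays like 1/M.
  have hpow : ((M : ℂ) ^ (1 + k)) ^ 2 = M ^ (1 / 6 + k) * M ^ (5 / 6 + k) * M := by
    rw [← Complex.cpow_add _ _ hM', ← Complex.cpow_nat_mul]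
    nth_rw 3 [← Complex.cpow_one (M : ℂ)]
    rw [← Complex.cpow_add _ _ hM']
    congr 1
    push_cast
    ring
  have n1 : (M : ℂ) ^ (1 / 6 + k) ≠ 0 := by simp [Complex.cpow_eq_zero_iff, hM']
  have n5 : (M : ℂ) ^ (5 / 6 + k) ≠ 0 := by simp [Complex.cpow_eq_zero_iff, hM']
  rw [normFactor, cpoch, cpoch, cpoch, Complex.Gamma_one, ← Gamma_sixth_mul]
  simp only [Pi.div_apply, ← add_assoc, div_pow, mul_pow, hpow, div_one]
  generalize (M : ℂ) ^ (1 / 6 + k) = u at *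
  generalize (M : ℂ) ^ (5 / 6 + k) = v at *
  rw [div_mul_div_comm, div_mul_div_comm]
  generalize Complex.Gamma (1 / 6 + k + _) = a
  generalize Complex.Gamma (5 / 6 + k + _) = b
  generalize Complex.Gamma (1 + k + _) = c
  field_simp

/-! ### The limit of the series for large parameters -/

theorem norm_poch_le {x y : ℂ} {c : ℝ} (hc : 0 ≤ c) (h : ∀ j : ℕ, ‖x + j‖ ≤ c * ‖y + j‖) (n : ℕ) :
    ‖poch x n‖ ≤ c ^ n * ‖poch y n‖ := by
  induction n with
  | zero => simp [poch_zero]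
  | succ n ih =>
    rw [poch_succ, poch_succ, norm_mul, norm_mul, pow_succ, mul_mul_mul_comm]
    exact mul_le_mul ih (h n) (norm_nonneg _) (by positivity)

theorem norm_le_norm_of_abs_re_le {z w : ℂ} (hre : |z.re| ≤ |w.re|) (him : |z.im| ≤ |w.im|) :
    ‖z‖ ≤ ‖w‖ := by
  rw [Complex.norm_def, Complex.norm_def]
  refine Real.sqrt_le_sqrt ?_
  rw [Complex.normSq_apply, Complex.normSq_apply]
  exact add_le_add (abs_le_iff_mul_self_le.1 hre) (abs_le_iff_mul_self_le.1 him)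

/-- Factor by factor, (1/2 - k)_n and (1/2 + 3k)_n are compared with (1 + k)_n, losing 1 and 3^n,
and 1/4, 3/4 with 1/2, 1. The bound 3/48 = 1/16 is uniform in the half-plane, as domination
requires. -/
theorem norm_hyperTerm_le {k : ℂ} (hk : 0 ≤ k.re) (n : ℕ) :
    ‖hyperTerm n k‖ ≤ (1 / 16) ^ n := by
  have hA : ‖poch (1 / 2 - k) n‖ ≤ 1 ^ n * ‖poch (1 + k) n‖ := by
    refine norm_poch_le zero_le_one (fun j => ?_) n
    have hj : (0 : ℝ) ≤ j := j.cast_nonneg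
    rw [one_mul]
    refine norm_le_norm_of_abs_re_le ?_ (by simp)
    simp
    rw [abs_of_nonneg (by linarith : 0 ≤ 1 + k.re + j), abs_le]
    constructor <;> linarith
  have hB : ‖poch (1 / 2 + 3 * k) n‖ ≤ 3 ^ n * ‖poch (1 + k) n‖ := by
    refine norm_poch_le (by norm_num) (fun j => ?_) n
    have hj : (0 : ℝ) ≤ j := j.cast_nonneg
    rw [show (3 : ℝ) = ‖(3 : ℂ)‖ by simp, ← norm_mul]
    refine norm_le_norm_of_abs_re_le ?_ (by simp)
    simp
    rw [abs_of_nonneg (by linarith), abs_of_nonneg (by linarith)]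
    linarith
  have hquarter : ∀ a b : ℝ, 0 ≤ a → a ≤ b → ‖poch a n‖ ≤ 1 ^ n * ‖poch b n‖ := by
    refine fun a b ha hab => norm_poch_le zero_le_one (fun j => ?_) n
    have hj : (0 : ℝ) ≤ j := j.cast_nonneg
    rw [one_mul]
    refine norm_le_norm_of_abs_re_le ?_ (by simp)
    simp
    rw [abs_of_nonneg (by linarith), abs_of_nonneg (by linarith)]
    linarith
  have hC := hquarter (1 / 4) (1 / 2) (by norm_num) (by norm_num)
  have hD := hquarter (3 / 4) 1 (by norm_num) (by norm_num)
  push_cast at hC hD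
  rw [one_pow, one_mul] at hA hC hD
  have hE := norm_pos_iff.2 (poch_half_ne_zero n)
  have hF := norm_pos_iff.2 (poch_one_ne_zero n)
  have hK := norm_pos_iff.2 (poch_ne_zero_of_re_pos (x := 1 + k) (by simp; linarith) n)
  rw [hyperTerm]
  simp only [norm_mul, norm_div, norm_pow]
  rw [show ‖(-1 : ℂ)‖ / ‖(48 : ℂ)‖ = 1 / 48 by simp,
    show (1 / 16 : ℝ) ^ n = (1 / 48) ^ n * 3 ^ n by rw [← mul_pow]; norm_num]
  refine mul_le_mul_of_nonneg_left ?_ (by positivity)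
  rw [div_le_iff₀ (by positivity)]
  calc _ ≤ ‖poch (1 + k) n‖ * (3 ^ n * ‖poch (1 + k) n‖) * ‖poch (1 / 2) n‖ * ‖poch 1 n‖ := by
        gcongr
    _ = _ := by ring

theorem tendsto_natCast_shift (a b c d : ℂ) (hd : d ≠ 0) :
    Tendsto (fun M : ℕ => (a + c * (M + 1 : ℕ)) / (b + d * (M + 1 : ℕ))) atTop (𝓝 (c / d)) :=
  (tendsto_add_atTop_iff_nat 1).2 (tendsto_add_mul_div_add_mul_atTop_nhds a b c hd)

theorem tendsto_poch_div (k a b c : ℂ) (n : ℕ) :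
    Tendsto (fun M : ℕ => poch (a + c * (k + (M + 1 : ℕ))) n / poch (b + (k + (M + 1 : ℕ))) n)
      atTop (𝓝 (c ^ n)) := by
  induction n with
  | zero => simp [poch_zero]
  | succ n ih =>
    have h := tendsto_natCast_shift (a + c * k + n) (b + k + n) c 1 one_ne_zero
    rw [div_one] at h
    refine (ih.mul h).congr fun M => ?_
    rw [poch_succ, poch_succ, mul_div_mul_comm]
    congr 2 <;> ring

theorem tendsto_linFactor_div (n : ℕ) (k : ℂ) :
    Tendsto (fun M : ℕ => linFactor n (k + (M + 1 : ℕ)) / (2 * n + 1) / M) atTop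
      (𝓝 ((40 * n + 18) / (2 * n + 1))) := by
  have h := (tendsto_add_mul_div_add_mul_atTop_nhds
    ((28 * (n : ℂ) + 3) * (2 * n + 1) + (k + 1) * (40 * n + 18)) 0 (40 * n + 18)
    (one_ne_zero (α := ℂ))).div_const (2 * (n : ℂ) + 1)
  rw [div_one] at h
  refine h.congr fun M => ?_
  rw [linFactor]
  push_cast
  rw [zero_add, one_mul]
  ring

theorem tendsto_summand_div (n : ℕ) (k : ℂ) :
    Tendsto (fun M : ℕ => summand n (k + (M + 1 : ℕ)) / M) atTop
      (𝓝 ((1 / 16 : ℂ) ^ n *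
      (poch (1 / 4) n * poch (3 / 4) n / (poch (1 / 2) n * poch 1 n)) *
      ((40 * n + 18) / (2 * n + 1)))) := by
  have h := (((tendsto_poch_div k (1 / 2) 1 (-1) n).mul
    (tendsto_poch_div k (1 / 2) 1 3 n)).const_mul ((-1 / 48 : ℂ) ^ n *
    (poch (1 / 4) n * poch (3 / 4) n / (poch (1 / 2) n * poch 1 n)))).mul
    (tendsto_linFactor_div n k)
  convert! h using 2 with M
  · rw [summand_eq, hyperTerm, neg_one_mul, ← sub_eq_add_neg]
    ring
  · rw [← mul_pow, mul_right_comm ((-1 / 48 : ℂ) ^ n), ← mul_pow]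
    norm_num

theorem tendsto_tsum_summand_div {k : ℂ} (hk : 0 ≤ k.re) :
    Tendsto (fun M : ℕ => (∑' n, summand n (k + (M + 1 : ℕ))) / M) atTop
      (𝓝 (32 / (√3 : ℝ))) := by
  rw [← hasSum_limit_series.tsum_eq]
  simp only [← tsum_div_const]
  -- For M ≥ 1, 28 + 20(‖k‖ + M + 1) ≤ (68 + 20‖k‖)M, so division by M leaves a majorant free of M.
  have hsum : Summable fun n : ℕ => (1 / 16 : ℝ) ^ n * ((68 + 20 * ‖k‖) * (n + 1)) := by
    have h1 := summable_pow_mul_geometric_of_norm_lt_one 1 (r := (1 / 16 : ℝ)) (by norm_num)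
    have h0 := summable_geometric_of_lt_one (r := (1 / 16 : ℝ)) (by norm_num) (by norm_num)
    refine ((h1.add h0).mul_left (68 + 20 * ‖k‖)).congr fun n => ?_
    ring
  refine tendsto_tsum_of_dominated_convergence hsum (fun n => tendsto_summand_div n k) ?_
  filter_upwards [eventually_ge_atTop 1] with M hM n
  have hM' : (1 : ℝ) ≤ M := by exact_mod_cast hM
  have hre : 0 ≤ (k + (M + 1 : ℕ)).re := by
    simp
    linarith
  have hl := norm_linFactor_div_le n (k + (M + 1 : ℕ))
  have hn : ‖k + (M + 1 : ℕ)‖ ≤ ‖k‖ + (M + 1) := by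
    refine (norm_add_le _ _).trans ?_
    rw [Complex.norm_natCast]
    push_cast
    exact le_rfl
  rw [summand_eq, mul_div_assoc, norm_mul]
  refine mul_le_mul (norm_hyperTerm_le hre n) ?_ (norm_nonneg _) (by positivity)
  rw [norm_div, Complex.norm_natCast, div_le_iff₀ (by positivity)]
  refine hl.trans ?_
  rw [mul_right_comm]
  refine mul_le_mul_of_nonneg_right ?_ (by positivity)
  have := mul_le_mul_of_nonneg_left hM' (norm_nonneg k)
  linarith

/-! ### Evaluation of the series -/

theorem ne_neg_of_re_nonneg {k : ℂ} (hk : 0 ≤ k.re) (m : ℕ) : k ≠ -((m : ℂ) + 1) := by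
  rintro rfl
  have : (0 : ℝ) ≤ m := m.cast_nonneg
  simp at hk
  linarith

theorem normFactor_mul_tsum_shift {k : ℂ} (hk : 0 ≤ k.re) (N : ℕ) :
    normFactor (k + N) * ∑' n, summand n (k + N) = normFactor k * ∑' n, summand n k := by
  induction N with
  | zero => simp
  | succ N ih =>
    have hN : (0 : ℝ) ≤ N := N.cast_nonneg
    have hre : 0 ≤ (k + N).re := by
      simp
      linarith
    have hne : ∀ a : ℝ, 0 < a → k + N + a ≠ 0 := fun a ha h => by
      have := congrArg Complex.re h
      simp at this hre
      linarith
    have h1 := hne (1 / 6) (by norm_num)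
    have h5 := hne (5 / 6) (by norm_num)
    have h6 := hne 1 (by norm_num)
    push_cast at h1 h5 h6
    rw [← ih, tsum_summand_eq (ne_neg_of_re_nonneg hre), Nat.cast_succ, ← add_assoc,
      normFactor_add_one h1 h5 h6]
    ring

theorem normFactor_mul_tsum {k : ℂ} (hk : 0 ≤ k.re) :
    normFactor k * ∑' n, summand n k = ((16 / (√3 * Real.pi) : ℝ) : ℂ) := by
  have h := (tendsto_normFactor hk).mul (tendsto_tsum_summand_div hk)
  have h' : Tendsto (fun _ : ℕ => normFactor k * ∑' n, summand n k) atTop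
      (𝓝 (1 / (2 * Real.pi) * (32 / (√3 : ℝ)))) := by
    refine h.congr' ?_
    filter_upwards [eventually_ne_atTop 0] with M hM
    have hM' : (M : ℂ) ≠ 0 := by exact_mod_cast hM
    rw [← normFactor_mul_tsum_shift hk (M + 1)]
    field_simp
  rw [tendsto_nhds_unique tendsto_const_nhds h']
  push_cast
  rw [div_mul_div_comm]
  ring

/-- 1/Γ is entire, so no parameter is excluded. Mathlib sets Γ to 0 at its poles, which gives 1/Γ
its true value 0 there and matches reading the right-hand side as 0. -/
theorem inv_cpoch (x k : ℂ) : (cpoch x k)⁻¹ = (x + k) * (cpoch x (k + 1))⁻¹ := by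
  have h := Complex.one_div_Gamma_eq_self_mul_one_div_Gamma_add_one (x + k)
  rw [cpoch, cpoch, inv_div, inv_div, ← add_assoc, div_eq_mul_inv, h]
  ring

theorem inv_normFactor {k : ℂ} (hk : k + 1 ≠ 0) :
    (normFactor k)⁻¹ = normRatio k * (normFactor (k + 1))⁻¹ := by
  have h6 := cpoch_add_one (x := 1) (k := k) (by rwa [add_comm])
  simp only [normFactor, inv_div]
  rw [div_eq_mul_inv, mul_inv, inv_cpoch (1 / 6), inv_cpoch (5 / 6), h6, normRatio, add_comm 1 k]
  generalize cpoch 1 k = c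
  field_simp
  ring

theorem tsum_summand {k : ℂ} (hk : ∀ m : ℕ, k ≠ -((m : ℂ) + 1)) :
    ∑' n, summand n k = ((16 / (√3 * Real.pi) : ℝ) : ℂ) * (normFactor k)⁻¹ := by
  -- N bounds the number of unit steps from k into the half-plane Re ≥ 0.
  obtain ⟨N, hN⟩ := exists_nat_ge (-k.re)
  induction N generalizing k with
  | zero =>
    have hre : 0 ≤ k.re := by simpa using hN
    rw [← normFactor_mul_tsum hre, mul_right_comm, mul_inv_cancel₀, one_mul]
    have hG : ∀ a : ℝ, 0 < a → cpoch a k ≠ 0 := fun a ha =>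
      div_ne_zero (Complex.Gamma_ne_zero_of_re_pos (by simp; linarith))
        (Complex.Gamma_ne_zero_of_re_pos (by simpa))
    have h1 := hG (1 / 6) (by norm_num)
    have h5 := hG (5 / 6) (by norm_num)
    have h6 := hG 1 (by norm_num)
    push_cast at h1 h5 h6
    exact div_ne_zero (mul_ne_zero h1 h5) (pow_ne_zero 2 h6)
  | succ N ih =>
    rw [tsum_summand_eq hk, ih (add_one_ne_neg hk) (by simp at hN ⊢; linarith),
      inv_normFactor (k := k) fun h => hk 0 (by push_cast; linear_combination h)]
    ring

theorem mainTheorem8 :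
    (∀ k : ℂ, (∀ m : ℕ, k ≠ -((m : ℂ) + 1)) →
      HasSum (fun n : ℕ => summand n k)
        (((16 / (Real.sqrt 3 * Real.pi) : ℝ) : ℂ) *
          (cpoch 1 k ^ 2 / (cpoch (1 / 6) k * cpoch (5 / 6) k)))) ∧
    WZDemonstrable genericParameters
      (fun n k => summand n k * (cpoch (1 / 6) k * cpoch (5 / 6) k / cpoch 1 k ^ 2)) := by
  refine ⟨fun k hk => ?_, _, isWZPair_mate_summand, fun k _ => by simp [mate], fun k hk => ?_⟩
  · rw [← inv_div (cpoch (1 / 6) k * cpoch (5 / 6) k)]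
    exact tsum_summand hk ▸ (summable_summand hk).hasSum
  · simpa using (tendsto_mate (genericParameters.ne_neg hk)).mul_const (normFactor k)
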